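/- Let $R$ be a commutative Noetherian ring, let $I, J$ be ideals of $R$, and let $\tilde W(I,J)$ be the set of ideals $\mathfrak a$ of $R$ with $I^n \subseteq \mathfrak a + J$ for some integer $n \ge 1$, directed by reverse inclusion. For an $R$-module $M$ and $i \ge 0$ define the $i$-th local homology module of $M$ with respect to $(I,J)$ by $$H_i^{I,J}(M) = \varprojlim_{\mathfrak a \in \tilde W(I,J)} \ \varprojlim_{t \in \mathbb N} \operatorname{Tor}_i^R(R/\mathfrak a^t, M).$$ The Noetherian dimension $\operatorname{Ndim}(M)$ is defined inductively: $\operatorname{Ndim}(M) = -1$ if $M = 0$; and for an ordinal $\alpha$, $\operatorname{Ndim}(M) = \alpha$ if $\operatorname{Ndim}(M) < \alpha$ is false and for every ascending chain $M_0 \subseteq M_1 \subseteq \cdots$ of submodules of $M$ there is $m_0$ with $\operatorname{Ndim}(M_{m+1}/M_m) < \alpha$ for all $m \ge m_0$. A topological $R$-module $M$ is called linearly compact if it is Hausdorff, has a base of neighbourhoods of $0$ consisting of submodules, and every family of cosets of closed submodules of $M$ with the finite intersection property has non-empty intersection. Theorem. Let $M$ be a linearly compact $R$-module with $\operatorname{Ndim}(M)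 = d$. Then $H_i^{I,J}(M) = 0$ for all integers $i \ge 0$ with $i > d$. -/

import Mathlib

open CategoryTheory CategoryTheory.Limits

universe u

/-- A topological `R`-module `M` is *linearly compact* if it is Hausdorff, linearly topologized
(the submodules that are neighbourhoods of `0` form a base of neighbourhoods of `0`), and every
family of cosets of closed submodules with the finite intersection property has a non-empty
intersection. No topology on `R` is needed: in a linear topology every scalar acts continuously. -/
class IsLinearlyCompactModule (R M : Type u) [CommRing R] [AddCommGroup M] [Module R M]
    [TopologicalSpace M] : Prop extends
    IsTopologicalAddGroup M, T2Space M, IsLinearTopology R M where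
  sInter_nonempty : ∀ F : Set (Set M),
    (∀ S ∈ F, ∃ (N : Submodule R M) (x : M),
      IsClosed (N : Set M) ∧ S = (fun n => x + n) '' (N : Set M)) →
    (∀ G : Set (Set M), G ⊆ F → G.Finite → (⋂₀ G).Nonempty) →
    (⋂₀ F).Nonempty

/-- `HasNdim R α M` says that the Noetherian dimension (in the sense of Roberts and Kirby) of the
`R`-module `M` exists and equals `α`, where `α` is `-1` (written `⊥`) or an ordinal. The dimension
of the zero module is `-1`; for an ordinal `α`, `Ndim M = α` if `Ndim M < α` is false and for
every ascending chain `N 0 ≤ N 1 ≤ ⋯` of submodules of `M` one has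
`Ndim (N (m + 1) / N m) < α` for all large `m`. -/
def HasNdim (R : Type u) [CommRing R] (α : WithBot Ordinal.{u}) (M : ModuleCat.{u} R) : Prop :=
  (α = ⊥ ∧ Subsingleton M) ∨
  (α ≠ ⊥ ∧ (¬ ∃ β : WithBot Ordinal.{u}, ∃ _ : β < α, HasNdim R β M) ∧
    ∀ N : ℕ → Submodule R M, Monotone N → ∃ m₀ : ℕ, ∀ m ≥ m₀,
      ∃ β : WithBot Ordinal.{u}, ∃ _ : β < α,
        HasNdim R β (ModuleCat.of R (N (m + 1) ⧸ (N m).submoduleOf (N (m + 1)))))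
termination_by (wellFounded_lt (α := WithBot Ordinal.{u})).wrap α
decreasing_by all_goals assumption

namespace LocalHomology

variable {R : Type u} [CommRing R]

/-- The set `W̃(I, J)` of the ideals `𝔞` with `I ^ n ≤ 𝔞 + J` for some `n ≥ 1`. As a category it is
ordered by inclusion, so that a functor on it is an inverse system for reverse inclusion. -/
def WTilde (I J : Ideal R) : Type u :=
  {𝔞 : Ideal R // ∃ n : ℕ, 1 ≤ n ∧ I ^ n ≤ 𝔞 ⊔ J}

instance (I J : Ideal R) : PartialOrder (WTilde I J) :=
  inferInstanceAs (PartialOrder {𝔞 : Ideal R // ∃ n : ℕ, 1 ≤ n ∧ I ^ n ≤ 𝔞 ⊔ J})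

/-- The `R`-modules `R ⧸ 𝔞 ^ t` for `𝔞` in `W̃(I, J)` and `t : ℕ`, with the natural projections
`R ⧸ 𝔟 ^ s ⟶ R ⧸ 𝔞 ^ t` for `𝔟 ≤ 𝔞` and `t ≤ s`. -/
noncomputable def quotientSystem (I J : Ideal R) : WTilde I J ⥤ ℕᵒᵖ ⥤ ModuleCat.{u} R where
  obj 𝔞 :=
    { obj := fun t => ModuleCat.of R (R ⧸ 𝔞.1 ^ t.unop)
      map := fun {_ _} f => ModuleCat.ofHom
        (Submodule.mapQ _ _ LinearMap.id (Ideal.pow_le_pow_right (leOfHom f.unop)))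
      map_id := fun _ => by ext; rfl
      map_comp := fun _ _ => by ext; rfl }
  map {_ _} f :=
    { app := fun t => ModuleCat.ofHom
        (Submodule.mapQ _ _ LinearMap.id (Ideal.pow_right_mono (leOfHom f) t.unop))
      naturality := fun _ _ _ => by ext; rfl }
  map_id := fun _ => by ext; rfl
  map_comp := fun _ _ => by ext; rfl

/-- The inverse system `𝔞 ↦ (t ↦ Tor_i (R ⧸ 𝔞 ^ t, M))`; here `Tor` is computed by a projective
resolution of its first argument. -/
noncomputable def torSystem (I J : Ideal R) (i : ℕ) (M : ModuleCat.{u} R) :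
    WTilde I J ⥤ ℕᵒᵖ ⥤ ModuleCat.{u} R :=
  quotientSystem I J ⋙
    (Functor.whiskeringRight ℕᵒᵖ _ _).obj ((Tor' (ModuleCat.{u} R) i).flip.obj M)

/-- The `i`-th local homology module of `M` with respect to the pair of ideals `(I, J)`:
the inverse limit over `𝔞` in `W̃(I, J)` of the inverse limits over `t` of
`Tor_i (R ⧸ 𝔞 ^ t, M)`. -/
noncomputable def localHomology (I J : Ideal R) (i : ℕ) (M : ModuleCat.{u} R) : ModuleCat.{u} R :=
  limit (torSystem I J i M ⋙ lim)

end LocalHomology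

/-! For a single ideal `𝔞`, the inverse system `t ↦ Tor_i (R ⧸ 𝔞 ^ t, M)` is pro-zero once `Ndim M <
i`: every term receives the zero map from a later one. Its limit over `t` then vanishes, and so does
the limit over `𝔞`.

Pro-vanishing passes along the long exact sequence of `Tor`, and `TorProZero.of_ndimLT` proves it by
induction on `i`. An inner induction on generators of `𝔞` reduces the step to modules killed by `𝔞`.
For a generator `x`, the chain `ker (x ^ m)` has, for large `m`, a successive quotient of dimension
below that of the step. This quotient is the kernel of `x` on `M ⧸ ker (x ^ m)`, so the outer
induction covers it, while the cokernel of `x` is killed by `x`. Up to transition maps, `Tor_{i+1}`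
of `M ⧸ ker (x ^ m)` is therefore divisible by every power of `x`; but `x ^ t` kills `R ⧸ 𝔞 ^ t`
(`TorProZero.of_ker_of_coker`). The submodule `ker (x ^ m)` is filtered by modules killed by `x`.

For modules killed by `𝔞` (`TorProZero.of_smul_eq_zero`), the source of vanishing is Artin–Rees
applied to `R ⧸ 𝔞`, followed by flat base change and dimension shifting. -/

namespace LocalHomology

open MonoidalCategory

variable {R : Type u} [CommRing R]

/-! ### Tensoring complexes of projectives with short exact sequences -/

/-- The functor `A ↦ Tor_i (A, M)`, derived in the first argument. -/
noncomputable abbrev torFst (M : ModuleCat.{u} R) (i : ℕ) : ModuleCat.{u} R ⥤ ModuleCat.{u} R :=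
  ((tensoringRight (ModuleCat.{u} R)).obj M).leftDerived i

/-- The transformation `Tor_i (-, M) ⟶ Tor_i (-, N)` induced by `M ⟶ N`. -/
noncomputable abbrev torFstMap {M N : ModuleCat.{u} R} (g : M ⟶ N) (i : ℕ) :
    torFst M i ⟶ torFst N i :=
  NatTrans.leftDerived ((tensoringRight (ModuleCat.{u} R)).map g) i

/-- The complex `P ⊗ M`. -/
noncomputable abbrev tensorComplex (P : ChainComplex (ModuleCat.{u} R) ℕ) (M : ModuleCat.{u} R) :
    ChainComplex (ModuleCat.{u} R) ℕ :=
  (((tensoringRight (ModuleCat.{u} R)).obj M).mapHomologicalComplex _).obj P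

/-- The short complex of complexes `P ⊗ S`. -/
noncomputable abbrev tensorShortComplex (P : ChainComplex (ModuleCat.{u} R) ℕ)
    (S : ShortComplex (ModuleCat.{u} R)) : ShortComplex (ChainComplex (ModuleCat.{u} R) ℕ) where
  X₁ := tensorComplex P S.X₁
  X₂ := tensorComplex P S.X₂
  X₃ := tensorComplex P S.X₃
  f := (NatTrans.mapHomologicalComplex ((tensoringRight _).map S.f) _).app P
  g := (NatTrans.mapHomologicalComplex ((tensoringRight _).map S.g) _).app P
  zero := by
    ext n : 1
    exact (MonoidalCategory.whiskerLeft_comp _ _ _).symm.trans (by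
      rw [S.zero]
      exact MonoidalPreadditive.whiskerLeft_zero)

/-- The functoriality of `P ⊗ S` in `P`. -/
noncomputable abbrev tensorShortComplexMap {P Q : ChainComplex (ModuleCat.{u} R) ℕ} (φ : P ⟶ Q)
    (S : ShortComplex (ModuleCat.{u} R)) : tensorShortComplex P S ⟶ tensorShortComplex Q S where
  τ₁ := (((tensoringRight (ModuleCat.{u} R)).obj S.X₁).mapHomologicalComplex _).map φ
  τ₂ := (((tensoringRight (ModuleCat.{u} R)).obj S.X₂).mapHomologicalComplex _).map φ
  τ₃ := (((tensoringRight (ModuleCat.{u} R)).obj S.X₃).mapHomologicalComplex _).map φ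
  comm₁₂ := NatTrans.mapHomologicalComplex_naturality ((tensoringRight _).map S.f) φ
  comm₂₃ := NatTrans.mapHomologicalComplex_naturality ((tensoringRight _).map S.g) φ

lemma shortExact_map_tensorLeft (P : ModuleCat.{u} R) [Module.Flat R P]
    {S : ShortComplex (ModuleCat.{u} R)} (hS : S.ShortExact) :
    (S.map (tensorLeft P)).ShortExact :=
  hS.map_of_exact _

lemma tensorShortComplex_shortExact (P : ChainComplex (ModuleCat.{u} R) ℕ)
    [∀ n, Projective (P.X n)] {S : ShortComplex (ModuleCat.{u} R)} (hS : S.ShortExact) :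
    (tensorShortComplex P S).ShortExact := by
  refine HomologicalComplex.shortExact_of_degreewise_shortExact _ fun n => ?_
  have : Module.Projective R (P.X n) := (IsProjective.iff_projective _).2 inferInstance
  exact shortExact_map_tensorLeft (P.X n) hS

/-! ### The long exact sequence of `Tor` in the second variable -/

section LongExactSequence

lemma exact_of_iso {X₁ X₂ X₃ Y₁ Y₂ Y₃ : ModuleCat.{u} R} {f : X₁ ⟶ X₂} {g : X₂ ⟶ X₃}
    {f' : Y₁ ⟶ Y₂} {g' : Y₂ ⟶ Y₃} (e₁ : X₁ ≅ Y₁) (e₂ : X₂ ≅ Y₂) (e₃ : X₃ ≅ Y₃)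
    (hf : f ≫ e₂.hom = e₁.hom ≫ f') (hg : g ≫ e₃.hom = e₂.hom ≫ g') (h : Function.Exact f' g') :
    Function.Exact f g := by
  have := Function.Exact.of_ladder_linearEquiv_of_exact (e₁ := e₁.symm.toLinearEquiv)
    (e₂ := e₂.symm.toLinearEquiv) (e₃ := e₃.symm.toLinearEquiv) (f₁₂ := f'.hom) (f₂₃ := g'.hom)
    (g₁₂ := f.hom) (g₂₃ := g.hom) ?_ ?_ h
  · exact this
  · have : e₁.inv ≫ f = f' ≫ e₂.inv := by
      rw [Iso.inv_comp_eq, ← Category.assoc, ← hf, Category.assoc, e₂.hom_inv_id, Category.comp_id]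
    exact congrArg ModuleCat.Hom.hom this
  · have : e₂.inv ≫ g = g' ≫ e₃.inv := by
      rw [Iso.inv_comp_eq, ← Category.assoc, ← hg, Category.assoc, e₃.hom_inv_id, Category.comp_id]
    exact congrArg ModuleCat.Hom.hom this

variable {S : ShortComplex (ModuleCat.{u} R)} (hS : S.ShortExact)

instance (A : ModuleCat.{u} R) (n : ℕ) : Projective ((projectiveResolution A).complex.X n) :=
  (projectiveResolution A).projective n

/-- `Tor_i (A, M)` computed by the chosen projective resolution of `A`. -/
noncomputable def torFstIso (A M : ModuleCat.{u} R) (i : ℕ) :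
    (torFst M i).obj A ≅ (tensorComplex (projectiveResolution A).complex M).homology i :=
  (projectiveResolution A).isoLeftDerivedObj _ _

lemma torFst_map_eq {A B : ModuleCat.{u} R} (f : A ⟶ B)
    (φ : (projectiveResolution A).complex ⟶ (projectiveResolution B).complex)
    (w : φ ≫ (projectiveResolution B).π =
      (projectiveResolution A).π ≫ (ChainComplex.single₀ _).map f) (M : ModuleCat.{u} R) (i : ℕ) :
    (torFst M i).map f = (torFstIso A M i).hom ≫ HomologicalComplex.homologyMap
      ((((tensoringRight (ModuleCat.{u} R)).obj M).mapHomologicalComplex _).map φ) i ≫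
      (torFstIso B M i).inv :=
  Functor.leftDerived_map_eq _ _ f _ w

lemma torFstMap_app (A : ModuleCat.{u} R) {M N : ModuleCat.{u} R} (g : M ⟶ N) (i : ℕ) :
    (torFstMap g i).app A = (torFstIso A M i).hom ≫
      HomologicalComplex.homologyMap ((NatTrans.mapHomologicalComplex
        ((tensoringRight (ModuleCat.{u} R)).map g) _).app (projectiveResolution A).complex) i ≫
      (torFstIso A N i).inv :=
  ProjectiveResolution.leftDerived_app_eq _ _ _

/-- The connecting map `Tor_{i+1} (A, S.X₃) ⟶ Tor_i (A, S.X₁)`. -/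
noncomputable def torδ (i : ℕ) (A : ModuleCat.{u} R) :
    (torFst S.X₃ (i + 1)).obj A ⟶ (torFst S.X₁ i).obj A :=
  (torFstIso A S.X₃ (i + 1)).hom ≫
    (tensorShortComplex_shortExact (projectiveResolution A).complex hS).δ (i + 1) i
      (ComplexShape.down_mk _ _ rfl) ≫
    (torFstIso A S.X₁ i).inv

/-- A lift of `f` to resolutions induces a morphism of short exact sequences of complexes. This
makes the connecting maps compatible with the transition maps of the inverse systems. -/
lemma torδ_naturality (i : ℕ) {A B : ModuleCat.{u} R} (f : A ⟶ B) :
    (torFst S.X₃ (i + 1)).map f ≫ torδ hS i B = torδ hS i A ≫ (torFst S.X₁ i).map f := by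
  have w := ProjectiveResolution.lift_commutes f (projectiveResolution A) (projectiveResolution B)
  have h := HomologicalComplex.HomologySequence.δ_naturality (tensorShortComplexMap
    (ProjectiveResolution.lift f (projectiveResolution A) (projectiveResolution B)) S)
    (tensorShortComplex_shortExact _ hS) (tensorShortComplex_shortExact _ hS) (i + 1) i
    (ComplexShape.down_mk _ _ rfl)
  rw [torFst_map_eq _ _ w, torFst_map_eq _ _ w, torδ, torδ]
  simp only [Category.assoc, Iso.inv_hom_id_assoc]
  rw [reassoc_of% h]

include hS in
lemma exact_torFstMap (i : ℕ) (A : ModuleCat.{u} R) :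
    Function.Exact ((torFstMap S.f i).app A) ((torFstMap S.g i).app A) := by
  have h := (tensorShortComplex_shortExact (projectiveResolution A).complex hS).homology_exact₂ i
  refine exact_of_iso (torFstIso A _ _)
    (torFstIso A _ _)
    (torFstIso A _ _) ?_ ?_
    ((ShortComplex.ShortExact.moduleCat_exact_iff_function_exact _).1 h)
  all_goals rw [torFstMap_app]; simp only [Category.assoc, Iso.inv_hom_id, Category.comp_id]

lemma torδ_torFstMap (i : ℕ) (A : ModuleCat.{u} R) :
    torδ hS i A ≫ (torFstMap S.f i).app A = 0 := by
  have h := (tensorShortComplex_shortExact (projectiveResolution A).complex hS).δ_comp (i + 1) i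
    (ComplexShape.down_mk _ _ rfl)
  rw [torFstMap_app, torδ]
  simp only [Category.assoc, Iso.inv_hom_id_assoc]
  rw [reassoc_of% h, Limits.zero_comp, Limits.comp_zero]

lemma exact_torFstMap_torδ (i : ℕ) (A : ModuleCat.{u} R) :
    Function.Exact ((torFstMap S.g (i + 1)).app A) (torδ hS i A) := by
  have h := (tensorShortComplex_shortExact
    (projectiveResolution A).complex hS).homology_exact₃ (i + 1) i
    (ComplexShape.down_mk _ _ rfl)
  refine exact_of_iso (torFstIso A _ _)
    (torFstIso A _ _)
    (torFstIso A _ _) ?_ ?_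
    ((ShortComplex.ShortExact.moduleCat_exact_iff_function_exact _).1 h)
  · rw [torFstMap_app]; simp only [Category.assoc, Iso.inv_hom_id, Category.comp_id]
  · rw [torδ]; simp only [Category.assoc, Iso.inv_hom_id, Category.comp_id]

end LongExactSequence

/-! ### Flat modules and flat base change -/

section Flat

lemma isZero_torFst_succ_of_flat (A F : ModuleCat.{u} R) [Module.Flat R F] (i : ℕ) :
    IsZero ((torFst F (i + 1)).obj A) := by
  refine IsZero.of_iso ?_ (torFstIso A F (i + 1))
  rw [← HomologicalComplex.exactAt_iff_isZero_homology]
  exact Module.Flat.rTensor_shortComplex_exact F _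
    ((projectiveResolution A).complex_exactAt_succ i)

lemma leftDerived_map_eq_zero_iff (G : ModuleCat.{u} R ⥤ ModuleCat.{u} R) [G.Additive]
    {A B : ModuleCat.{u} R} (f : A ⟶ B) (i : ℕ) :
    (G.leftDerived i).map f = 0 ↔ HomologicalComplex.homologyMap
      ((G.mapHomologicalComplex _).map (ProjectiveResolution.lift f (projectiveResolution A)
        (projectiveResolution B))) i = 0 := by
  have w := ProjectiveResolution.lift_commutes f (projectiveResolution A) (projectiveResolution B)
  rw [Functor.leftDerived_map_eq _ _ f _ w]
  exact (Preadditive.IsIso.comp_left_eq_zero _ _).trans (Preadditive.IsIso.comp_right_eq_zero _ _)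

/-- An exact `H` commutes with homology, so the map in question is, up to isomorphism, `H` applied
to a zero map. -/
lemma leftDerived_comp_map_eq_zero (G H : ModuleCat.{u} R ⥤ ModuleCat.{u} R) [G.Additive]
    [H.Additive] [PreservesFiniteLimits H] [PreservesFiniteColimits H] {A B : ModuleCat.{u} R}
    (f : A ⟶ B) (i : ℕ) (h : (G.leftDerived i).map f = 0) :
    ((G ⋙ H).leftDerived i).map f = 0 := by
  rw [leftDerived_map_eq_zero_iff] at h ⊢
  set φ := ProjectiveResolution.lift f (projectiveResolution A) (projectiveResolution B)
  have := ShortComplex.mapHomologyIso_hom_naturality (F := H)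
    ((HomologicalComplex.shortComplexFunctor _ _ i).map ((G.mapHomologicalComplex _).map φ))
  rw [show ShortComplex.homologyMap ((HomologicalComplex.shortComplexFunctor _ _ i).map
    ((G.mapHomologicalComplex _).map φ)) = 0 from h, H.map_zero, comp_zero] at this
  exact (cancel_mono (ShortComplex.mapHomologyIso _ H).hom).1 (this.trans zero_comp.symm)

lemma leftDerived_map_eq_zero_of_iso {G H : ModuleCat.{u} R ⥤ ModuleCat.{u} R} [G.Additive]
    [H.Additive] (e : G ≅ H) {A B : ModuleCat.{u} R} (f : A ⟶ B) (i : ℕ)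
    (h : (G.leftDerived i).map f = 0) : (H.leftDerived i).map f = 0 := by
  have h₁ : (NatTrans.leftDerived e.inv i).app A ≫ (NatTrans.leftDerived e.hom i).app A = 𝟙 _ := by
    rw [← NatTrans.comp_app, ← NatTrans.leftDerived_comp, e.inv_hom_id, NatTrans.leftDerived_id,
      NatTrans.id_app]
  rw [← Category.id_comp ((H.leftDerived i).map f), ← h₁, Category.assoc,
    ← (NatTrans.leftDerived e.hom i).naturality, h, zero_comp, comp_zero]

lemma torFst_tensor_map_eq_zero (M F : ModuleCat.{u} R) [Module.Flat R F] {A B : ModuleCat.{u} R}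
    (f : A ⟶ B) (i : ℕ) (h : (torFst M i).map f = 0) : (torFst (M ⊗ F) i).map f = 0 :=
  leftDerived_map_eq_zero_of_iso (G := (tensoringRight _).obj M ⋙ tensorRight F)
    (H := (tensoringRight _).obj (M ⊗ F)) (NatIso.ofComponents (fun A => α_ A M F)
      (fun f => associator_naturality_left f M F)) f i
    (leftDerived_comp_map_eq_zero _ _ f i h)

end Flat

/-! ### `Tor_0` as the tensor product -/

section Zero

/-- The natural map `Tor_0 (A, M) ⟶ A ⊗ M`. -/
noncomputable def torFstZero (A M : ModuleCat.{u} R) : (torFst M 0).obj A ⟶ A ⊗ M :=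
  ((tensoringRight (ModuleCat.{u} R)).obj M).fromLeftDerivedZero.app A

lemma torFstZero_injective (A M : ModuleCat.{u} R) : Function.Injective (torFstZero A M) := by
  have : PreservesFiniteColimits ((tensoringRight (ModuleCat.{u} R)).obj M) :=
    inferInstanceAs (PreservesFiniteColimits (tensorRight M))
  have : IsIso (torFstZero A M) := by
    delta torFstZero
    infer_instance
  exact (ModuleCat.mono_iff_injective _).1 inferInstance

lemma torFstZero_naturality {A B : ModuleCat.{u} R} (f : A ⟶ B) (M : ModuleCat.{u} R) :
    (torFst M 0).map f ≫ torFstZero B M = torFstZero A M ≫ f ▷ M :=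
  ((tensoringRight (ModuleCat.{u} R)).obj M).fromLeftDerivedZero.naturality f

lemma torFstZero_eq (A M : ModuleCat.{u} R) :
    torFstZero A M = (torFstIso A M 0).hom ≫ HomologicalComplex.homologyι _ 0 ≫
      (projectiveResolution A).fromLeftDerivedZero' ((tensoringRight (ModuleCat.{u} R)).obj M) :=
  (projectiveResolution A).fromLeftDerivedZero_eq _

lemma torFstMap_torFstZero {M N : ModuleCat.{u} R} (g : M ⟶ N) (A : ModuleCat.{u} R) :
    (torFstMap g 0).app A ≫ torFstZero A N = torFstZero A M ≫ A ◁ g := by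
  have h : HomologicalComplex.opcyclesMap ((NatTrans.mapHomologicalComplex
        ((tensoringRight (ModuleCat.{u} R)).map g) _).app (projectiveResolution A).complex) 0 ≫
      (projectiveResolution A).fromLeftDerivedZero' ((tensoringRight (ModuleCat.{u} R)).obj N) =
      (projectiveResolution A).fromLeftDerivedZero' ((tensoringRight (ModuleCat.{u} R)).obj M) ≫
        A ◁ g := by
    -- The projection to opcycles is epi, so the square is checked on degree-zero chains.
    rw [← cancel_epi (HomologicalComplex.pOpcycles _ _), HomologicalComplex.p_opcyclesMap_assoc,
      ProjectiveResolution.pOpcycles_comp_fromLeftDerivedZero',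
      ProjectiveResolution.pOpcycles_comp_fromLeftDerivedZero'_assoc]
    exact whisker_exchange _ _
  rw [torFstMap_app, torFstZero_eq, torFstZero_eq]
  simp only [Category.assoc, Iso.inv_hom_id_assoc]
  rw [HomologicalComplex.homologyι_naturality_assoc, h]

end Zero

section Smul

/-- Scalars cross the tensor sign. This turns a factorization of `x` on `M` into information about
`x` on `R ⧸ 𝔞 ^ t`. -/
lemma torFst_map_smul (M A : ModuleCat.{u} R) (x : R) (i : ℕ) :
    (torFst M i).map (x • 𝟙 A) = (torFstMap (x • 𝟙 M) i).app A := by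
  rw [torFst_map_eq (x • 𝟙 A) (x • 𝟙 _) ?_, torFstMap_app]
  · congr 3
    ext n : 1
    apply ModuleCat.hom_ext
    apply TensorProduct.ext'
    intro p m
    exact TensorProduct.smul_tmul x p m
  · apply HomologicalComplex.to_single_hom_ext
    have h (B : ModuleCat.{u} R) (p : B ⟶ A) : x • p = p ≫ (x • 𝟙 A) := by simp
    simp only [HomologicalComplex.comp_f, HomologicalComplex.smul_f_apply,
      Linear.smul_comp, Category.id_comp,
      ChainComplex.single₀_map_f_zero]
    exact h _ _

end Smul

/-! ### Pro-zero systems and short exact sequences -/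

/-- The projection `R ⧸ 𝔞 ^ s ⟶ R ⧸ 𝔞 ^ t` for `t ≤ s`. -/
noncomputable def powProj (𝔞 : Ideal R) {s t : ℕ} (h : t ≤ s) :
    ModuleCat.of R (R ⧸ 𝔞 ^ s) ⟶ ModuleCat.of R (R ⧸ 𝔞 ^ t) :=
  ModuleCat.ofHom (Submodule.mapQ _ _ LinearMap.id (Ideal.pow_le_pow_right h))

lemma powProj_comp (𝔞 : Ideal R) {r s t : ℕ} (h : s ≤ r) (h' : t ≤ s) :
    powProj 𝔞 h ≫ powProj 𝔞 h' = powProj 𝔞 (h'.trans h) := by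
  ext
  rfl

/-- The inverse system `t ↦ Tor_i (R ⧸ 𝔞 ^ t, M)` is pro-zero. -/
def TorProZero (𝔞 : Ideal R) (i : ℕ) (M : ModuleCat.{u} R) : Prop :=
  ∀ t, ∃ s, ∃ h : t ≤ s, (torFst M i).map (powProj 𝔞 h) = 0

lemma TorProZero.of_isZero {𝔞 : Ideal R} {i : ℕ} {M : ModuleCat.{u} R}
    (h : ∀ A, IsZero ((torFst M i).obj A)) : TorProZero 𝔞 i M :=
  fun t => ⟨t, le_rfl, (h _).eq_of_src _ _⟩

lemma TorProZero.of_flat (𝔞 : Ideal R) (i : ℕ) (F : ModuleCat.{u} R) [Module.Flat R F] :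
    TorProZero 𝔞 (i + 1) F :=
  .of_isZero fun A => isZero_torFst_succ_of_flat A F i

lemma torFstMap_naturality_apply {M N A B : ModuleCat.{u} R} (g : M ⟶ N) (i : ℕ) (f : A ⟶ B)
    (u : (torFst M i).obj A) :
    (torFst N i).map f ((torFstMap g i).app A u) = (torFstMap g i).app B ((torFst M i).map f u) :=
  (congr($((torFstMap g i).naturality f) u)).symm

lemma torδ_naturality_apply {S : ShortComplex (ModuleCat.{u} R)} (hS : S.ShortExact) (i : ℕ)
    {A B : ModuleCat.{u} R} (f : A ⟶ B) (u : (torFst S.X₃ (i + 1)).obj A) :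
    torδ hS i B ((torFst S.X₃ (i + 1)).map f u) = (torFst S.X₁ i).map f (torδ hS i A u) :=
  congr($(torδ_naturality hS i f) u)

lemma torFst_map_powProj_comp (𝔞 : Ideal R) {r s t : ℕ} (h : s ≤ r) (h' : t ≤ s) (i : ℕ)
    (M : ModuleCat.{u} R) (u : (torFst M i).obj (ModuleCat.of R (R ⧸ 𝔞 ^ r))) :
    (torFst M i).map (powProj 𝔞 (h'.trans h)) u =
      (torFst M i).map (powProj 𝔞 h') ((torFst M i).map (powProj 𝔞 h) u) := by
  rw [← powProj_comp 𝔞 h h', Functor.map_comp]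
  rfl

lemma torFst_map_apply_eq_zero {M A B : ModuleCat.{u} R} {i : ℕ} {f : A ⟶ B}
    (h : (torFst M i).map f = 0) (u : (torFst M i).obj A) : (torFst M i).map f u = 0 := by
  rw [h]; rfl

/-- One transition kills the image in `S.X₃`, so the element comes from `S.X₁`, where a second
transition kills it. -/
lemma TorProZero.middle {𝔞 : Ideal R} {i : ℕ} {S : ShortComplex (ModuleCat.{u} R)}
    (hS : S.ShortExact) (h₁ : TorProZero 𝔞 i S.X₁) (h₃ : TorProZero 𝔞 i S.X₃) :
    TorProZero 𝔞 i S.X₂ := by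
  intro t
  obtain ⟨s, hts, hs⟩ := h₁ t
  obtain ⟨r, hsr, hr⟩ := h₃ s
  refine ⟨r, hts.trans hsr, ?_⟩
  ext u
  rw [torFst_map_powProj_comp 𝔞 hsr hts]
  obtain ⟨v, hv⟩ := (exact_torFstMap hS i _ ((torFst S.X₂ i).map (powProj 𝔞 hsr) u)).1
    (by rw [← torFstMap_naturality_apply]; exact torFst_map_apply_eq_zero hr _)
  rw [← hv, torFstMap_naturality_apply, torFst_map_apply_eq_zero hs, map_zero]
  rfl

lemma TorProZero.right {𝔞 : Ideal R} {i : ℕ} {S : ShortComplex (ModuleCat.{u} R)}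
    (hS : S.ShortExact) (h₂ : TorProZero 𝔞 (i + 1) S.X₂) (h₁ : TorProZero 𝔞 i S.X₁) :
    TorProZero 𝔞 (i + 1) S.X₃ := by
  intro t
  obtain ⟨s, hts, hs⟩ := h₂ t
  obtain ⟨r, hsr, hr⟩ := h₁ s
  refine ⟨r, hts.trans hsr, ?_⟩
  ext u
  rw [torFst_map_powProj_comp 𝔞 hsr hts]
  obtain ⟨v, hv⟩ := (exact_torFstMap_torδ hS i _ ((torFst S.X₃ (i + 1)).map (powProj 𝔞 hsr) u)).1
    (by rw [torδ_naturality_apply]; exact torFst_map_apply_eq_zero hr _)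
  rw [← hv, torFstMap_naturality_apply, torFst_map_apply_eq_zero hs, map_zero]
  rfl

lemma shortExact_of_submodule {M : Type u} [AddCommGroup M] [Module R M] (N : Submodule R M) :
    (ShortComplex.mk (ModuleCat.ofHom N.subtype) (ModuleCat.ofHom N.mkQ)
      (by ext x; simp)).ShortExact :=
  ModuleCat.shortComplex_shortExact _ (LinearMap.exact_subtype_mkQ N) N.subtype_injective
    N.mkQ_surjective

lemma shortExact_ker {M N : Type u} [AddCommGroup M] [Module R M] [AddCommGroup N] [Module R N]
    (f : M →ₗ[R] N) (hf : Function.Surjective f) :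
    (ShortComplex.mk (ModuleCat.ofHom (LinearMap.ker f).subtype) (ModuleCat.ofHom f)
      (by ext x; simp)).ShortExact :=
  ModuleCat.shortComplex_shortExact _ (LinearMap.exact_subtype_ker_map f)
    (LinearMap.ker f).subtype_injective hf


lemma torFst_map_zero (M A B : ModuleCat.{u} R) (i : ℕ) :
    (torFst M i).map (0 : A ⟶ B) = 0 := by
  rw [torFst_map_eq 0 0 (by simp), Functor.map_zero, HomologicalComplex.homologyMap_zero,
    zero_comp, comp_zero]

lemma torFstMap_comp {M N L : ModuleCat.{u} R} (g : M ⟶ N) (g' : N ⟶ L) (i : ℕ) :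
    torFstMap (g ≫ g') i = torFstMap g i ≫ torFstMap g' i := by
  rw [torFstMap, Functor.map_comp, NatTrans.leftDerived_comp]

/-! ### Divisibility by an element of the ideal -/

section Divisibility

variable {𝔞 : Ideal R} {i : ℕ} {x : R} {M : Type u} [AddCommGroup M] [Module R M]

/-- Factor `x` as `M ↠ xM ↪ M`. One transition lifts `u` to `Tor` of `xM`, since `M ⧸ xM` is
pro-zero; a second kills the obstruction in `Tor_i` of the kernel and lifts it to `Tor` of `M`. -/
lemma exists_torFst_map_eq_smul
    (h₁ : TorProZero 𝔞 i (.of R (LinearMap.ker (LinearMap.lsmul R M x))))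
    (h₃ : TorProZero 𝔞 (i + 1) (.of R (M ⧸ LinearMap.range (LinearMap.lsmul R M x)))) (t : ℕ) :
    ∃ s, ∃ h : t ≤ s, ∀ u, ∃ w, (torFst (.of R M) (i + 1)).map (powProj 𝔞 h) u =
      (torFst (.of R M) (i + 1)).map (x • 𝟙 _) w := by
  set f := LinearMap.lsmul R M x with hf
  have hS := shortExact_ker f.rangeRestrict f.surjective_rangeRestrict
  have hT := shortExact_of_submodule (LinearMap.range f)
  have h₁' : TorProZero 𝔞 i (.of R (LinearMap.ker f.rangeRestrict)) := by
    rwa [LinearMap.ker_rangeRestrict]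
  obtain ⟨s, hts, hs⟩ := h₁' t
  obtain ⟨r, hsr, hr⟩ := h₃ s
  refine ⟨r, hts.trans hsr, fun u => ?_⟩
  obtain ⟨v, hv⟩ := (exact_torFstMap hT (i + 1) _
    ((torFst (.of R M) (i + 1)).map (powProj 𝔞 hsr) u)).1
    (by rw [← torFstMap_naturality_apply]; exact torFst_map_apply_eq_zero hr _)
  obtain ⟨w, hw⟩ := (exact_torFstMap_torδ hS i _
    ((torFst (.of R (LinearMap.range f)) (i + 1)).map (powProj 𝔞 hts) v)).1
    (by
      have := torδ_naturality_apply hS i (powProj 𝔞 hts) v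
      refine this.trans (torFst_map_apply_eq_zero hs _))
  refine ⟨w, ?_⟩
  rw [torFst_map_powProj_comp 𝔞 hsr hts, torFst_map_smul]
  have hx : (x • 𝟙 (ModuleCat.of R M)) =
      ModuleCat.ofHom f.rangeRestrict ≫ ModuleCat.ofHom (LinearMap.range f).subtype := by
    ext m
    rfl
  rw [hx, torFstMap_comp, NatTrans.comp_app]
  refine Eq.trans ?_ (congrArg ((torFstMap (ModuleCat.ofHom (LinearMap.range f).subtype)
    (i + 1)).app _) hw.symm)
  rw [← hv]
  exact torFstMap_naturality_apply _ _ _ _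

lemma exists_torFst_map_eq_pow_smul
    (h₁ : TorProZero 𝔞 i (.of R (LinearMap.ker (LinearMap.lsmul R M x))))
    (h₃ : TorProZero 𝔞 (i + 1) (.of R (M ⧸ LinearMap.range (LinearMap.lsmul R M x)))) (t k : ℕ) :
    ∃ s, ∃ h : t ≤ s, ∀ u, ∃ w, (torFst (.of R M) (i + 1)).map (powProj 𝔞 h) u =
      (torFst (.of R M) (i + 1)).map (x ^ k • 𝟙 _) w := by
  induction k with
  | zero => exact ⟨t, le_rfl, fun u => ⟨(torFst (.of R M) (i + 1)).map (powProj 𝔞 le_rfl) u, by simp⟩⟩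
  | succ k ih =>
    obtain ⟨s, hts, hs⟩ := ih
    obtain ⟨r, hsr, hr⟩ := exists_torFst_map_eq_smul h₁ h₃ s
    refine ⟨r, hts.trans hsr, fun u => ?_⟩
    obtain ⟨v, hv⟩ := hr u
    obtain ⟨w, hw⟩ := hs v
    refine ⟨w, ?_⟩
    have e₁ : (x • 𝟙 _) ≫ powProj 𝔞 hts = powProj 𝔞 hts ≫ (x • 𝟙 _) := by simp
    have e₂ : (x ^ (k + 1) • 𝟙 (ModuleCat.of R (R ⧸ 𝔞 ^ t))) = (x ^ k • 𝟙 _) ≫ (x • 𝟙 _) := by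
      simp [smul_smul, pow_succ, mul_comm]
    rw [torFst_map_powProj_comp 𝔞 hsr hts, hv, e₂, ← ConcreteCategory.comp_apply, ← Functor.map_comp,
      e₁, Functor.map_comp, Functor.map_comp, ConcreteCategory.comp_apply, hw]
    rfl

/-- Multiplication by an element `x ∈ 𝔞` transfers pro-vanishing of `Tor` from the kernel and the
cokernel of `x` on `M` to `M` itself. -/
lemma TorProZero.of_ker_of_coker (hx : x ∈ 𝔞)
    (h₁ : TorProZero 𝔞 i (.of R (LinearMap.ker (LinearMap.lsmul R M x))))
    (h₃ : TorProZero 𝔞 (i + 1) (.of R (M ⧸ LinearMap.range (LinearMap.lsmul R M x)))) :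
    TorProZero 𝔞 (i + 1) (.of R M) := by
  intro t
  -- The exponent equals the level `t`, because `x ^ t ∈ 𝔞 ^ t` annihilates `R ⧸ 𝔞 ^ t`.
  obtain ⟨s, hts, hs⟩ := exists_torFst_map_eq_pow_smul h₁ h₃ t t
  refine ⟨s, hts, ?_⟩
  ext u
  obtain ⟨w, hw⟩ := hs u
  have h0 : (x ^ t • 𝟙 (ModuleCat.of R (R ⧸ 𝔞 ^ t))) = 0 := by
    ext
    exact Ideal.Quotient.eq_zero_iff_mem.2
      (Ideal.mul_mem_right _ _ (Ideal.pow_mem_pow hx t))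
  rw [hw, h0, torFst_map_apply_eq_zero (torFst_map_zero _ _ _ _)]
  rfl

end Divisibility

/-! ### `Tor_1` and induced adic topologies -/

section Shift

lemma exists_eq_one_tmul (𝔟 : Ideal R) {K : Type u} [AddCommGroup K] [Module R K]
    (y : TensorProduct R (R ⧸ 𝔟) K) : ∃ k : K, y = 1 ⊗ₜ[R] k := by
  obtain ⟨k, hk⟩ := Submodule.mkQ_surjective _ (TensorProduct.quotTensorEquivQuotSMul K 𝔟 y)
  refine ⟨k, (TensorProduct.quotTensorEquivQuotSMul K 𝔟).injective ?_⟩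
  rw [TensorProduct.quotTensorEquivQuotSMul_mk_one_tmul, ← hk]
  rfl

lemma one_tmul_eq_zero_iff (𝔟 : Ideal R) {K : Type u} [AddCommGroup K] [Module R K] (k : K) :
    (1 : R ⧸ 𝔟) ⊗ₜ[R] k = 0 ↔ k ∈ (𝔟 • ⊤ : Submodule R K) := by
  rw [← (TensorProduct.quotTensorEquivQuotSMul K 𝔟).map_eq_zero_iff,
    TensorProduct.quotTensorEquivQuotSMul_mk_one_tmul, Submodule.Quotient.mk_eq_zero]

/-- If the `𝔞`-adic topology on a flat module induces the `𝔞`-adic topology on the kernel `K` of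
`F → N`, then the system `Tor_1 (R ⧸ 𝔞 ^ t, N)` is pro-zero. -/
lemma TorProZero.one_of_ker {𝔞 : Ideal R} {F N : Type u} [AddCommGroup F] [Module R F]
    [AddCommGroup N] [Module R N] [Module.Flat R F] (f : F →ₗ[R] N) (hf : Function.Surjective f)
    (H : ∀ t, ∃ s, t ≤ s ∧ ∀ k : LinearMap.ker f, (k : F) ∈ (𝔞 ^ s • ⊤ : Submodule R F) →
      k ∈ (𝔞 ^ t • ⊤ : Submodule R (LinearMap.ker f))) : TorProZero 𝔞 1 (.of R N) := by
  intro t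
  obtain ⟨s, hts, hs⟩ := H t
  have hS := shortExact_ker f hf
  refine ⟨s, hts, ?_⟩
  ext u
  -- The connecting image of `u` dies in `F ⧸ 𝔞 ^ s F`, so it is represented by some `k ∈ K ∩ 𝔞 ^ s
  -- F`.
  have h₁ : (ModuleCat.of R (R ⧸ 𝔞 ^ s) ◁ ModuleCat.ofHom (LinearMap.ker f).subtype)
      (torFstZero _ _ (torδ hS 0 _ u)) = 0 := by
    rw [← ConcreteCategory.comp_apply, ← torFstMap_torFstZero, ConcreteCategory.comp_apply,
      show (torFstMap (ModuleCat.ofHom (LinearMap.ker f).subtype) 0).app _ (torδ hS 0 _ u) = 0 from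
        congr($(torδ_torFstMap hS 0 _) u), map_zero]
  obtain ⟨k, hk⟩ := exists_eq_one_tmul (𝔞 ^ s) (torFstZero _ _ (torδ hS 0 _ u))
  rw [hk] at h₁
  have h₂ := hs k ((one_tmul_eq_zero_iff _ _).1 h₁)
  have h₃ : torδ hS 0 _ ((torFst (.of R N) 1).map (powProj 𝔞 hts) u) = 0 := by
    apply torFstZero_injective
    rw [map_zero]
    refine (congrArg (torFstZero _ _) (torδ_naturality_apply hS 0 (powProj 𝔞 hts) u)).trans ?_
    refine congr($(torFstZero_naturality (powProj 𝔞 hts) _) (torδ hS 0 _ u)).trans ?_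
    refine (congrArg (powProj 𝔞 hts ▷ _) hk).trans ?_
    exact (one_tmul_eq_zero_iff _ _).2 h₂
  obtain ⟨w, hw⟩ := (exact_torFstMap_torδ hS 0 _ _).1 h₃
  have : Subsingleton ((torFst (.of R F) 1).obj (ModuleCat.of R (R ⧸ 𝔞 ^ t))) :=
    ModuleCat.subsingleton_of_isZero (isZero_torFst_succ_of_flat _ (.of R F) 0)
  refine hw.symm.trans ?_
  rw [Subsingleton.elim w 0, map_zero]
  rfl

end Shift

lemma TorProZero.of_surjective {𝔞 : Ideal R} {i : ℕ} {F N : Type u} [AddCommGroup F] [Module R F]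
    [AddCommGroup N] [Module R N] (f : F →ₗ[R] N) (hf : Function.Surjective f)
    (h₂ : TorProZero 𝔞 (i + 1) (.of R F)) (h₁ : TorProZero 𝔞 i (.of R (LinearMap.ker f))) :
    TorProZero 𝔞 (i + 1) (.of R N) :=
  TorProZero.right (S := .mk (ModuleCat.ofHom (LinearMap.ker f).subtype)
    (ModuleCat.ofHom f) _)
    (shortExact_ker f hf) h₂ h₁

lemma TorProZero.of_submodule {𝔞 : Ideal R} {i : ℕ} {M : Type u} [AddCommGroup M] [Module R M]
    (N : Submodule R M) (h₁ : TorProZero 𝔞 i (.of R N)) (h₃ : TorProZero 𝔞 i (.of R (M ⧸ N))) :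
    TorProZero 𝔞 i (.of R M) :=
  TorProZero.middle (S := .mk (ModuleCat.ofHom N.subtype) (ModuleCat.ofHom N.mkQ) _)
    (shortExact_of_submodule N) h₁ h₃

lemma smul_top_le_ker {𝔞 : Ideal R} {X F : Type u} [AddCommGroup X] [Module R X]
    [AddCommGroup F] [Module R F] (hX : ∀ a ∈ 𝔞, ∀ x : X, a • x = 0) (f : F →ₗ[R] X) :
    (𝔞 • ⊤ : Submodule R F) ≤ LinearMap.ker f :=
  Submodule.smul_le.2 fun a ha y _ => by rw [LinearMap.mem_ker, map_smul, hX a ha]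

lemma smul_quotTensor_eq_zero {𝔞 : Ideal R} {F : Type u} [AddCommGroup F] [Module R F]
    (a : R) (ha : a ∈ 𝔞) (y : TensorProduct R (R ⧸ 𝔞) F) : a • y = 0 := by
  obtain ⟨k, rfl⟩ := exists_eq_one_tmul 𝔞 y
  rw [← TensorProduct.tmul_smul, one_tmul_eq_zero_iff]
  exact Submodule.smul_mem_smul ha trivial

/-! ### Artin–Rees and modules killed by the ideal -/

section Noetherian

variable [IsNoetherianRing R]

lemma TorProZero.of_finite (𝔞 : Ideal R) (i : ℕ) (N : Type u) [AddCommGroup N] [Module R N]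
    [Module.Finite R N] : TorProZero 𝔞 (i + 1) (.of R N) := by
  induction i generalizing N with
  | zero =>
    obtain ⟨n, f, hf⟩ := Module.Finite.exists_fin' R N
    refine one_of_ker f hf fun t => ?_
    obtain ⟨k, hk⟩ := Ideal.exists_pow_inf_eq_pow_smul 𝔞 (LinearMap.ker f)
    -- With `k` the Artin–Rees constant, `K ∩ 𝔞 ^ (t + k) F = 𝔞 ^ t (K ∩ 𝔞 ^ k F)`.
    refine ⟨t + k, by omega, fun x hx => ?_⟩
    have h := (hk (t + k) (by omega)).le ⟨hx, x.2⟩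
    rw [Nat.add_sub_cancel] at h
    exact (Submodule.mem_smul_top_iff _ _ _).2 (Submodule.smul_mono le_rfl inf_le_right h)
  | succ i ih =>
    obtain ⟨n, f, hf⟩ := Module.Finite.exists_fin' R N
    exact of_surjective f hf (of_flat 𝔞 _ (.of R (Fin n → R))) (ih _)

/-- In degree one, `𝔞 F ⊆ K` gives `𝔞 ^ (t + 1) F ⊆ 𝔞 ^ t K`. In higher degrees `X` is covered by
`(R ⧸ 𝔞) ⊗ F` rather than by `F`, so that the kernel is again killed by `𝔞` and the induction
applies. -/
lemma TorProZero.of_smul_eq_zero (𝔞 : Ideal R) (i : ℕ) (X : Type u) [AddCommGroup X] [Module R X]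
    (hX : ∀ a ∈ 𝔞, ∀ x : X, a • x = 0) : TorProZero 𝔞 (i + 1) (.of R X) := by
  induction i generalizing X with
  | zero =>
    refine one_of_ker (Finsupp.linearCombination R (id : X → X))
      (Finsupp.linearCombination_id_surjective R X) fun t => ⟨t + 1, by omega, fun k hk => ?_⟩
    rw [pow_succ, Submodule.mul_smul] at hk
    exact (Submodule.mem_smul_top_iff _ _ _).2 (Submodule.smul_mono le_rfl
      (smul_top_le_ker hX _) hk)
  | succ i ih =>
    let p := Finsupp.linearCombination R (id : X → X)
    let g := (𝔞 • ⊤ : Submodule R (X →₀ R)).liftQ p (smul_top_le_ker hX p) ∘ₗ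
      (TensorProduct.quotTensorEquivQuotSMul (X →₀ R) 𝔞).toLinearMap
    have hp : Function.Surjective p := Finsupp.linearCombination_id_surjective R X
    have hg : Function.Surjective g := by
      refine Function.Surjective.comp (g := (Submodule.liftQ _ p (smul_top_le_ker hX p)))
        (fun x => ?_) (TensorProduct.quotTensorEquivQuotSMul _ 𝔞).surjective
      obtain ⟨y, rfl⟩ := hp x
      exact ⟨Submodule.mkQ _ y, rfl⟩
    refine of_surjective g hg (fun t => ?_) (ih _ fun a ha x => ?_)
    · obtain ⟨s, hts, hs⟩ := of_finite 𝔞 (i + 1) (R ⧸ 𝔞) t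
      exact ⟨s, hts, torFst_tensor_map_eq_zero (.of R (R ⧸ 𝔞)) (.of R (X →₀ R)) _ _ hs⟩
    · exact Subtype.ext (smul_quotTensor_eq_zero a ha x.1)

end Noetherian

/-! ### Finite bounds on the Noetherian dimension -/

section NoetherianDimension

variable (R) in
/-- The Noetherian dimension of `M` is less than the natural number `n`. -/
def NdimLT : ℕ → (M : Type u) → [AddCommGroup M] → [Module R M] → Prop
  | 0, M, _, _ => Subsingleton M
  | n + 1, M, _, _ => ∀ N : ℕ → Submodule R M, Monotone N → ∃ m₀ : ℕ, ∀ m ≥ m₀,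
      NdimLT n (N (m + 1) ⧸ (N m).submoduleOf (N (m + 1)))

lemma NdimLT.of_injective {n : ℕ} {M M' : Type u} [AddCommGroup M] [Module R M] [AddCommGroup M']
    [Module R M'] (f : M' →ₗ[R] M) (hf : Function.Injective f) (h : NdimLT R n M) :
    NdimLT R n M' := by
  induction n generalizing M M' with
  | zero =>
    have : Subsingleton M := h
    exact hf.subsingleton
  | succ n ih =>
    intro N hN
    obtain ⟨m₀, hm₀⟩ := h (fun m => (N m).map f) fun _ _ hab => Submodule.map_mono (hN hab)
    refine ⟨m₀, fun m hm => ih (Submodule.mapQ ((N m).submoduleOf (N (m + 1)))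
      (((N m).map f).submoduleOf ((N (m + 1)).map f)) (f.submoduleMap (N (m + 1)))
      fun x hx => ⟨x.1, hx, rfl⟩) ?_ (hm₀ m hm)⟩
    rw [injective_iff_map_eq_zero]
    rintro ⟨y⟩ hy
    obtain ⟨z, hz, hzy⟩ := (Submodule.Quotient.mk_eq_zero _).1 hy
    refine (Submodule.Quotient.mk_eq_zero _).2 ?_
    rwa [hf hzy] at hz

lemma NdimLT.of_surjective {n : ℕ} {M M' : Type u} [AddCommGroup M] [Module R M] [AddCommGroup M']
    [Module R M'] (f : M →ₗ[R] M') (hf : Function.Surjective f) (h : NdimLT R n M) :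
    NdimLT R n M' := by
  induction n generalizing M M' with
  | zero =>
    have : Subsingleton M := h
    exact hf.subsingleton
  | succ n ih =>
    intro N hN
    obtain ⟨m₀, hm₀⟩ := h (fun m => (N m).comap f) fun _ _ hab => Submodule.comap_mono (hN hab)
    refine ⟨m₀, fun m hm => ih (Submodule.mapQ _ _ (f.restrict (p := (N (m + 1)).comap f)
      fun x hx => hx) fun x hx => hx) ?_ (hm₀ m hm)⟩
    rintro ⟨y⟩
    obtain ⟨x, hx⟩ := hf y.1
    exact ⟨Submodule.Quotient.mk ⟨x, by rw [Submodule.mem_comap, hx]; exact y.2⟩,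
      congrArg Submodule.Quotient.mk (Subtype.ext hx)⟩

lemma NdimLT.of_subsingleton (n : ℕ) (M : Type u) [AddCommGroup M] [Module R M] [Subsingleton M] :
    NdimLT R n M := by
  induction n generalizing M with
  | zero => assumption
  | succ n ih => exact fun N _ => ⟨0, fun m _ => ih _⟩

/-- An upper bound needs only the chain condition, not the minimality clause; below a natural number
the transfinite recursion becomes recursion on `ℕ`. -/
lemma NdimLT.of_hasNdim {n : ℕ} {d : WithBot Ordinal.{u}} {M : ModuleCat.{u} R}
    (hM : HasNdim R d M) (hd : d < ((n : Ordinal.{u}) : WithBot Ordinal.{u})) : NdimLT R n M := by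
  induction n generalizing d M with
  | zero =>
    rw [HasNdim] at hM
    rcases hM with hM | hM
    · exact hM.2
    · obtain ⟨α, rfl⟩ := WithBot.ne_bot_iff_exists.1 hM.1
      simp at hd
  | succ n ih =>
    rw [HasNdim] at hM
    rcases hM with hM | ⟨hbot, -, hM⟩
    · have := hM.2
      exact of_subsingleton _ _
    · intro N hN
      obtain ⟨m₀, hm₀⟩ := hM N hN
      refine ⟨m₀, fun m hm => ?_⟩
      obtain ⟨β, hβ, h⟩ := hm₀ m hm
      refine ih h (hβ.trans_le ?_)
      obtain ⟨α, rfl⟩ := WithBot.ne_bot_iff_exists.1 hbot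
      rw [WithBot.coe_lt_coe, Nat.cast_succ, Order.lt_add_one_iff] at hd
      exact WithBot.coe_le_coe.2 hd

end NoetherianDimension

/-! ### Induction on the dimension and on the generators -/

lemma TorProZero.of_subsingleton (𝔞 : Ideal R) (i : ℕ) (M : Type u) [AddCommGroup M] [Module R M]
    [Subsingleton M] : TorProZero 𝔞 i (.of R M) := by
  cases i with
  | zero =>
    refine .of_isZero fun A => ?_
    have : Subsingleton (TensorProduct R A M) := inferInstance
    have : Subsingleton ((torFst (.of R M) 0).obj A) :=
      (torFstZero_injective A (.of R M)).subsingleton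
    exact ModuleCat.isZero_of_subsingleton _
  | succ i => exact of_flat 𝔞 i (.of R M)

/-- The step on the generators of `𝔞`: for `x ∈ 𝔞` it suffices to treat modules killed by `x`, since
the chain of the kernels of `x ^ m` on `M` has quotients of smaller dimension in the end. -/
lemma torProZero_of_forall_smul {𝔞 : Ideal R} {i : ℕ} {x : R} (hx : x ∈ 𝔞) (T : Set R)
    (ih : ∀ (M : Type u) [AddCommGroup M] [Module R M], NdimLT R i M → TorProZero 𝔞 i (.of R M))
    (H : ∀ (M : Type u) [AddCommGroup M] [Module R M], NdimLT R (i + 1) M →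
      (∀ a ∈ insert x T, ∀ m : M, a • m = 0) → TorProZero 𝔞 (i + 1) (.of R M))
    (M : Type u) [AddCommGroup M] [Module R M] (hM : NdimLT R (i + 1) M)
    (hT : ∀ a ∈ T, ∀ m : M, a • m = 0) : TorProZero 𝔞 (i + 1) (.of R M) := by
  have hquot {M : Type u} [AddCommGroup M] [Module R M] (hT : ∀ a ∈ T, ∀ m : M, a • m = 0)
      (N : Submodule R M) : ∀ a ∈ T, ∀ m : M ⧸ N, a • m = 0 := by
    rintro a ha ⟨m⟩
    exact congrArg Submodule.Quotient.mk (hT a ha m)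
  have key (k : ℕ) (M : Type u) [AddCommGroup M] [Module R M] (hM : NdimLT R (i + 1) M)
      (hT : ∀ a ∈ T, ∀ m : M, a • m = 0) (hk : ∀ m : M, x ^ k • m = 0) :
      TorProZero 𝔞 (i + 1) (.of R M) := by
    induction k generalizing M with
    | zero =>
      have : Subsingleton M := subsingleton_of_forall_eq 0 fun m => by simpa using hk m
      exact .of_subsingleton _ _ _
    | succ k ihk =>
      let N := LinearMap.ker (LinearMap.lsmul R M (x ^ k))
      refine .of_submodule N (ihk N (hM.of_injective N.subtype N.subtype_injective)
        (fun a ha m => Subtype.ext (hT a ha _)) fun m => Subtype.ext m.2)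
        (H _ (hM.of_surjective N.mkQ N.mkQ_surjective) ?_)
      rintro a (rfl | ha)
      · rintro ⟨m⟩
        refine (Submodule.Quotient.mk_eq_zero N).2 ?_
        change a ^ k • a • m = 0
        rw [smul_smul, ← pow_succ, hk]
      · exact hquot hT N a ha
  let N (m : ℕ) : Submodule R M := LinearMap.ker (LinearMap.lsmul R M (x ^ m))
  have hNmem (m : ℕ) (y : M) : y ∈ N m ↔ x ^ m • y = 0 := Iff.rfl
  obtain ⟨m, hm⟩ := hM N (monotone_nat_of_le_succ fun m y hy => by
    rw [hNmem] at hy ⊢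
    rw [pow_succ', mul_smul, hy, smul_zero])
  replace hm := hm m le_rfl
  refine .of_submodule (N m) (key m _ (hM.of_injective (N m).subtype (N m).subtype_injective)
    (fun a ha y => Subtype.ext (hT a ha _)) fun y => Subtype.ext y.2) ?_
  refine .of_ker_of_coker hx (ih _ ?_) (H _ ((hM.of_surjective (N m).mkQ
    (N m).mkQ_surjective).of_surjective (Submodule.mkQ _) (Submodule.mkQ_surjective _)) ?_)
  -- If `x` kills the class of `y` modulo `ker (x ^ m)`, then `y ∈ ker (x ^ (m + 1))`; hence `N (m +
  -- 1) ⧸ N m` maps onto the kernel of `x`.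
  · let g : N (m + 1) →ₗ[R] LinearMap.ker (LinearMap.lsmul R (M ⧸ N m) x) :=
      LinearMap.codRestrict _ ((N m).mkQ ∘ₗ (N (m + 1)).subtype) fun y =>
        (Submodule.Quotient.mk_eq_zero (N m)).2 (by
          rw [hNmem, smul_smul, ← pow_succ]
          exact y.2)
    refine hm.of_surjective (Submodule.liftQ _ g fun y hy => Subtype.ext
      ((Submodule.Quotient.mk_eq_zero (N m)).2 hy)) ?_
    rintro ⟨⟨y⟩, hy⟩
    have hy' : x ^ m • x • y = 0 := (Submodule.Quotient.mk_eq_zero (N m)).1 hy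
    exact ⟨Submodule.Quotient.mk ⟨y, by rwa [hNmem, pow_succ, mul_smul]⟩, rfl⟩
  · rintro a (rfl | ha)
    · rintro ⟨y⟩
      exact (Submodule.Quotient.mk_eq_zero _).2 ⟨y, rfl⟩
    · exact hquot (hquot hT _) _ a ha

/-- Over a Noetherian ring the system `t ↦ Tor_i (R ⧸ 𝔞 ^ t, M)` is pro-zero as soon as the
Noetherian dimension of `M` is less than `i`. Pro-vanishing makes the passage to the limit harmless,
so that linear compactness of `M`, which ensures exactness of inverse limits, is not needed. -/
theorem TorProZero.of_ndimLT [IsNoetherianRing R] (𝔞 : Ideal R) (i : ℕ) (M : Type u)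
    [AddCommGroup M] [Module R M] (hM : NdimLT R i M) : TorProZero 𝔞 i (.of R M) := by
  induction i generalizing M with
  | zero =>
    have : Subsingleton M := hM
    exact .of_subsingleton _ _ _
  | succ i ih =>
    obtain ⟨s, hs⟩ := IsNoetherian.noetherian 𝔞
    classical
    -- The generators are discarded one at a time, until no annihilation condition on the module
    -- remains.
    have key (T : Finset R) (hT : (T : Set R) ⊆ 𝔞)
        (H : ∀ (M : Type u) [AddCommGroup M] [Module R M], NdimLT R (i + 1) M →
          (∀ a ∈ (T : Set R), ∀ m : M, a • m = 0) → TorProZero 𝔞 (i + 1) (.of R M)) :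
        ∀ (M : Type u) [AddCommGroup M] [Module R M], NdimLT R (i + 1) M →
          TorProZero 𝔞 (i + 1) (.of R M) := by
      induction T using Finset.induction_on with
      | empty => exact fun M _ _ hM => H M hM (by simp)
      | insert x T _ ihT =>
        rw [Finset.coe_insert] at hT H
        exact ihT ((Set.subset_insert _ _).trans hT)
          (torProZero_of_forall_smul (hT (Set.mem_insert _ _)) _ ih H)
    refine key s (hs ▸ Submodule.subset_span) (fun M _ _ _ h => .of_smul_eq_zero _ _ _ ?_) M hM
    intro a ha m
    have hle : Submodule.span R (s : Set R) ≤ LinearMap.ker (LinearMap.toSpanSingleton R _ m) :=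
      Submodule.span_le.2 fun b hb => h b hb m
    exact hle (hs ▸ ha)

/-- Every projection from the limit factors through a zero transition map. -/
lemma isZero_limit_of_torProZero {I J : Ideal R} (𝔞 : WTilde I J) (i : ℕ) (M : ModuleCat.{u} R)
    (h : TorProZero 𝔞.1 i M) : IsZero (limit ((torSystem I J i M).obj 𝔞)) := by
  rw [IsZero.iff_id_eq_zero]
  refine limit.hom_ext fun t => ?_
  obtain ⟨s, hts, hs⟩ := h t.unop
  have h0 : ((torSystem I J i M).obj 𝔞).map (homOfLE hts).op = 0 := hs
  rw [Category.id_comp, zero_comp, ← limit.w _ (homOfLE hts).op, h0, comp_zero]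

end LocalHomology

theorem mainTheorem3 {R : Type u} [CommRing R] [IsNoetherianRing R] (I J : Ideal R)
    (M : Type u) [AddCommGroup M] [Module R M] [TopologicalSpace M]
    [IsLinearlyCompactModule R M]
    (d : WithBot Ordinal.{u}) (hd : HasNdim R d (ModuleCat.of R M))
    (i : ℕ) (hi : d < ((i : Ordinal.{u}) : WithBot Ordinal.{u})) :
    Subsingleton (LocalHomology.localHomology I J i (ModuleCat.of R M)) := by
  refine ModuleCat.subsingleton_of_isZero ?_
  rw [LocalHomology.localHomology, IsZero.iff_id_eq_zero]
  refine limit.hom_ext fun 𝔞 => ?_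
  exact (LocalHomology.isZero_limit_of_torProZero 𝔞 i (.of R M)
    (.of_ndimLT _ i M (.of_hasNdim hd hi))).eq_of_tgt _ _
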